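/- An *idiom* is a complete modular lattice $A$ such that $a\wedge\bigvee X=\bigvee\{a\wedge x : x\in X\}$ for every $a\in A$ and every directed $X\subseteq A$. A *nucleus* on $A$ is a map $j\colon A\to A$ with $x\le j(x)$, $j(j(x))=j(x)$ and $j(x\wedge y)=j(x)\wedge j(y)$; the set $N(A)$ of all nuclei, ordered pointwise, is a complete lattice with top $tp$, $tp(a)=1$ for all $a$. Put $A_j=\{a\in A : j(a)=a\}$. A *division set* is a nonempty set $\mathcal D$ of intervals $[a,b]$ ($a\le b$ in $A$) such that: for all $l,r\in A$, $[l,l\vee r]\in\mathcal D$ if and only if $[l\wedge r,r]\in\mathcal D$; subintervals of members of $\mathcal D$ belong to $\mathcal D$; if $[a,b],[b,c]\in\mathcal D$ then $[a,c]\in\mathcal D$; and if $X\subseteq[a,1]$ is nonempty and $[a,x]\in\mathcal D$ for all $x\in X$, then $[a,\bigvee X]\in\mathcal D$. For $j\in N(A)$ let $\mathcal D_j$ be the set of intervals $[a,b]$ with $j(a)=j(b)$, let $\mathcal F_j$ be the set of intervals $[a,b]$ such that for every $x\in[a,b]$ there is $y\in[a,b]$ with $x\wedge y=a$ and $[x\vee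 y,b]\in\mathcal D_j$, and let $\mathcal B_j$ be the least division set containing $\mathcal F_j$. The *Boyle derivative* of $j$ is the nucleus $Boy(j)(a)=\bigvee\{x\ge a : [a,x]\in\mathcal B_j\}$. Put $Boy^0(j)=j$, $Boy^{\alpha+1}(j)=Boy(Boy^\alpha(j))$, and $Boy^\lambda(j)=\bigvee_{\alpha<\lambda}Boy^\alpha(j)$ in $N(A)$ for limit ordinals $\lambda$; this increasing chain is eventually constant, and $Boy^\infty(j)$ denotes its eventual value. For $a,b\in A$ write $a\lessdot b$ if $a\le b$ and, for every $y\in A$, $b\wedge y\le a$ implies $y\le a$. A nonempty $\mathcal K\subseteq A$ is *cohesive* if for each $a\in\mathcal K$ there is $X\subseteq\mathcal K$ with $a=\bigwedge X$ and $a\lessdot x$ for all $x\in X$. **Theorem.** Let $A$ be an idiom and $j$ a nucleus on $A$. 1. $Boy^\infty(j)=tp$ if and only if $\{1\}$ is the only cohesive subset of $A_j$. 2. $A_{Boy^\infty(j)}$ is the largest cohesive subset of $A_j$ (with respect to inclusion). 3. $Boy^\infty(j)=j$ if and only if $A_j$ is cohesive. -/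

import Mathlib

universe u

/-- An idiom: a complete, upper-continuous, modular lattice. -/
class IsIdiom (A : Type u) [CompleteLattice A] : Prop extends IsModularLattice A where
  /-- The idiom distributive law, for directed (nonempty) sets. -/
  inf_sSup_directed : ∀ (a : A) (X : Set A), X.Nonempty → DirectedOn (· ≤ ·) X →
    a ⊓ sSup X = ⨆ x ∈ X, a ⊓ x

namespace Idiom

section Intervals

variable {A : Type u} [CompleteLattice A]

/-- The interval `[a, b]`. The order `J ≤ I` on `NonemptyInterval A` is "`J` is a subinterval
of `I`". -/
def ivl (a b : A) (h : a ≤ b) : NonemptyInterval A := ⟨(a, b), h⟩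

/-- Similarity of intervals: one of them is `[l, l ∨ r]` and the other one `[l ∧ r, r]`. -/
def Similar (J I : NonemptyInterval A) : Prop :=
  ∃ l r : A,
    (J = ivl l (l ⊔ r) le_sup_left ∧ I = ivl (l ⊓ r) r inf_le_right) ∨
    (J = ivl (l ⊓ r) r inf_le_right ∧ I = ivl l (l ⊔ r) le_sup_left)

/-- Abstract sets of intervals. -/
structure IsAbstract (B : Set (NonemptyInterval A)) : Prop where
  nonempty : B.Nonempty
  similar : ∀ J I : NonemptyInterval A, Similar J I → I ∈ B → J ∈ B

/-- Basic sets of intervals. -/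
structure IsBasic (B : Set (NonemptyInterval A)) : Prop extends IsAbstract B where
  subinterval : ∀ J I : NonemptyInterval A, J ≤ I → I ∈ B → J ∈ B

/-- Division sets of intervals: basic sets closed under abutting intervals (`abut`) and under
suprema of right end points (`sup`). -/
structure IsDivision (D : Set (NonemptyInterval A)) : Prop extends IsBasic D where
  abut : ∀ (a b c : A) (hab : a ≤ b) (hbc : b ≤ c),
    ivl a b hab ∈ D → ivl b c hbc ∈ D → ivl a c (hab.trans hbc) ∈ D
  sup : ∀ (a : A) (X : Set A) (_ : X.Nonempty) (hX : ∀ x ∈ X, a ≤ x)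
    (h : a ≤ sSup X), (∀ (x : A) (hx : x ∈ X), ivl a x (hX x hx) ∈ D) → ivl a (sSup X) h ∈ D

/-- The intersection of all division sets that contain `B`. -/
def Dvs (B : Set (NonemptyInterval A)) : Set (NonemptyInterval A) :=
  ⋂₀ {D | IsDivision D ∧ B ⊆ D}

/-- The set of `B`-full intervals. -/
def Fll (B : Set (NonemptyInterval A)) : Set (NonemptyInterval A) :=
  {I | ∀ x, I.fst ≤ x → x ≤ I.snd → ∃ y, I.fst ≤ y ∧ y ≤ I.snd ∧ I.fst = x ⊓ y ∧
    ∃ h : x ⊔ y ≤ I.snd, ivl (x ⊔ y) I.snd h ∈ B}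

/-- The function `|B|` associated with a set `B` of intervals. -/
def assoc (B : Set (NonemptyInterval A)) (a : A) : A :=
  sSup {x | ∃ h : a ≤ x, ivl a x h ∈ B}

/-- The division set of a nucleus. -/
def divOf (j : Nucleus A) : Set (NonemptyInterval A) :=
  {I | j I.fst = j I.snd}

theorem IsBasic.refl_mem {B : Set (NonemptyInterval A)} (hB : IsBasic B) (a : A) :
    ivl a a le_rfl ∈ B := by
  obtain ⟨I, hI⟩ := hB.nonempty
  have h1 : ivl I.fst I.fst le_rfl ∈ B := hB.subinterval _ I ⟨le_rfl, I.fst_le_snd⟩ hI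
  have h2 : ivl ⊥ ⊥ le_rfl ∈ B :=
    hB.similar _ _ ⟨I.fst, ⊥, Or.inr ⟨by simp [ivl], by simp [ivl]⟩⟩ h1
  exact hB.similar _ _ ⟨a, ⊥, Or.inl ⟨by simp [ivl], by simp [ivl]⟩⟩ h2

/-- If `[l, m]` is in a basic set, `r ≤ m` and `k = l ∧ r`, then `[k, r]` is in it. -/
theorem IsBasic.inf_mem {B : Set (NonemptyInterval A)} (hB : IsBasic B) {l m r k : A}
    (hlm : l ≤ m) (hm : ivl l m hlm ∈ B) (hr : r ≤ m) (hk : k = l ⊓ r) (hkr : k ≤ r) :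
    ivl k r hkr ∈ B := by
  subst hk
  have h1 : ivl l (l ⊔ r) le_sup_left ∈ B :=
    hB.subinterval _ (ivl l m hlm) ⟨le_refl l, sup_le hlm hr⟩ hm
  exact hB.similar _ _ ⟨l, r, Or.inr ⟨rfl, rfl⟩⟩ h1

/-- If `[k, r]` is in a basic set and `k ≤ l`, then `[l, l ∨ r]` is in it. -/
theorem IsBasic.sup_mem {B : Set (NonemptyInterval A)} (hB : IsBasic B) {l r k : A}
    (hkr : k ≤ r) (hm : ivl k r hkr ∈ B) (hk : k ≤ l) :
    ivl l (l ⊔ r) le_sup_left ∈ B := by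
  have h1 : ivl (l ⊓ r) r inf_le_right ∈ B :=
    hB.subinterval _ (ivl k r hkr) ⟨le_inf hk hkr, le_refl r⟩ hm
  exact hB.similar _ _ ⟨l, r, Or.inl ⟨rfl, rfl⟩⟩ h1

theorem IsDivision.le_assoc {D : Set (NonemptyInterval A)} (hD : IsDivision D) (a : A) :
    a ≤ assoc D a :=
  le_sSup (show a ∈ {x | ∃ h : a ≤ x, ivl a x h ∈ D} from ⟨le_rfl, hD.refl_mem a⟩)

theorem IsDivision.assoc_mem {D : Set (NonemptyInterval A)} (hD : IsDivision D) (a : A) :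
    ivl a (assoc D a) (hD.le_assoc a) ∈ D :=
  hD.sup a {x | ∃ h : a ≤ x, ivl a x h ∈ D} ⟨a, le_rfl, hD.refl_mem a⟩ (fun _ hx => hx.1)
    (hD.le_assoc a) (fun _ hx => hx.2)

theorem IsDivision.assoc_mono {D : Set (NonemptyInterval A)} (hD : IsDivision D) :
    Monotone (assoc D) := by
  intro a b hab
  exact le_sup_right.trans
    (le_sSup ⟨le_sup_left, hD.sup_mem (hD.le_assoc a) (hD.assoc_mem a) hab⟩)

/-- The nucleus `|D|` associated with a division set `D`. -/
def nucleusOf (D : Set (NonemptyInterval A)) (hD : IsDivision D) : Nucleus A where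
  toFun := assoc D
  map_inf' a b := by
    apply le_antisymm
    · exact le_inf (hD.assoc_mono inf_le_left) (hD.assoc_mono inf_le_right)
    · have h1 : ivl (a ⊓ b) (a ⊓ assoc D b) (inf_le_inf_left a (hD.le_assoc b)) ∈ D :=
        hD.inf_mem (hD.le_assoc b) (hD.assoc_mem b) inf_le_right
          (by rw [← inf_assoc, inf_comm b a, inf_assoc, inf_eq_left.2 (hD.le_assoc b)]) _
      have h2 : ivl (a ⊓ assoc D b) (assoc D a ⊓ assoc D b)
          (inf_le_inf_right _ (hD.le_assoc a)) ∈ D :=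
        hD.inf_mem (hD.le_assoc a) (hD.assoc_mem a) inf_le_left
          (by rw [← inf_assoc, inf_eq_left.2 (hD.le_assoc a)]) _
      exact le_sSup ⟨_, hD.abut _ _ _ _ _ h1 h2⟩
  idempotent' a := le_sSup ⟨_, hD.abut _ _ _ _ _ (hD.assoc_mem a) (hD.assoc_mem (assoc D a))⟩
  le_apply' a := hD.le_assoc a

theorem isDivision_univ : IsDivision (Set.univ : Set (NonemptyInterval A)) where
  nonempty := ⟨ivl ⊥ ⊥ le_rfl, trivial⟩
  similar _ _ _ _ := trivial
  subinterval _ _ _ _ := trivial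
  abut _ _ _ _ _ _ _ := trivial
  sup _ _ _ _ _ _ := trivial

/-- `Dvs B` is a division set, hence the least one that contains `B`. -/
theorem isDivision_Dvs (B : Set (NonemptyInterval A)) : IsDivision (Dvs B) where
  nonempty := ⟨ivl ⊥ ⊥ le_rfl, fun _ hD => hD.1.refl_mem ⊥⟩
  similar J I h hI D hD := hD.1.similar J I h (hI D hD)
  subinterval J I h hI D hD := hD.1.subinterval J I h (hI D hD)
  abut a b c hab hbc h1 h2 D hD := hD.1.abut a b c hab hbc (h1 D hD) (h2 D hD)
  sup a X hne hX h hx D hD := hD.1.sup a X hne hX h (fun x hxX => hx x hxX D hD)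

/-- The Boyle derivative on nuclei: `Boy(j)` is the nucleus of the division set
`Dvs(Fll(D_j))`. -/
def Boy (j : Nucleus A) : Nucleus A :=
  nucleusOf (Dvs (Fll (divOf j))) (isDivision_Dvs _)

theorem le_Boy (j : Nucleus A) : j ≤ Boy j := by
  intro a
  refine le_sSup ⟨j.le_apply, fun D hD => hD.2 ?_⟩
  intro x hax hxj
  refine ⟨a, le_rfl, j.le_apply, (inf_eq_right.2 hax).symm, sup_le hxj j.le_apply, ?_⟩
  change j (x ⊔ a) = j (j a)
  have hax' : a ≤ x := hax
  have hxj' : x ≤ j a := hxj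
  rw [sup_eq_left.2 hax']
  exact le_antisymm (j.monotone hxj') ((j.idempotent a).le.trans (j.monotone hax'))

end Intervals

section Iteration

variable {L : Type u} [CompleteLattice L]

/-- The transfinite iterates `d^α(x)`. -/
noncomputable def iter (d : L → L) (x : L) (α : Ordinal.{u}) : L :=
  Ordinal.limitRecOn α x (fun _ y => d y) (fun o _ f => ⨆ β : Set.Iio o, f β.1 β.2)

/-- The ordinals at which the chain `d^α(x)` has become stationary. -/
def stableOrdinals (d : L → L) (x : L) : Set Ordinal.{u} :=
  {γ | ∀ α, γ ≤ α → iter d x α = iter d x γ}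

/-- `d^∞(x)`: the value of the chain `d^α(x)` at the least ordinal at which it is stationary. -/
noncomputable def iterInf (d : L → L) (x : L) : L :=
  iter d x (sInf (stableOrdinals d x))

theorem iter_zero (d : L → L) (x : L) : iter d x 0 = x :=
  Ordinal.limitRecOn_zero ..

theorem iter_succ (d : L → L) (x : L) (α : Ordinal.{u}) :
    iter d x (α + 1) = d (iter d x α) :=
  Ordinal.limitRecOn_add_one ..

theorem iter_limit (d : L → L) (x : L) (o : Ordinal.{u}) (ho : Order.IsSuccLimit o) :
    iter d x o = ⨆ β : Set.Iio o, iter d x β.1 :=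
  Ordinal.limitRecOn_limit _ _ _ _ ho

theorem iter_mono {d : L → L} (hd : ∀ y, y ≤ d y) (x : L) : Monotone (iter d x) := by
  intro α β
  induction β using Ordinal.limitRecOn with
  | zero => intro h; rw [nonpos_iff_eq_zero.1 h]
  | add_one β ih =>
    intro h
    rcases h.lt_or_eq with h | h
    · rw [iter_succ]
      exact (ih (Order.lt_add_one_iff.1 h)).trans (hd _)
    · rw [h]
  | limit β hβ _ =>
    intro h
    rcases h.lt_or_eq with h | h
    · rw [iter_limit d x β hβ]
      exact le_iSup (fun γ : Set.Iio β => iter d x γ.1) ⟨α, h⟩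
    · rw [h]

theorem stableOrdinals_nonempty {d : L → L} (hd : ∀ y, y ≤ d y) (x : L) :
    (stableOrdinals d x).Nonempty := by
  have key : ∃ γ, iter d x (γ + 1) = iter d x γ := by
    by_contra hne
    push Not at hne
    have hlt : StrictMono (iter d x) := by
      intro α β hαβ
      have h1 : iter d x α < iter d x (α + 1) :=
        lt_of_le_of_ne (iter_mono hd x (Order.le_succ α)) (hne α).symm
      exact h1.trans_le (iter_mono hd x (Order.add_one_le_of_lt hαβ))
    exact not_injective_of_ordinal (iter d x) hlt.injective
  obtain ⟨γ, hγ⟩ := key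
  rw [iter_succ] at hγ
  refine ⟨γ, fun α => ?_⟩
  induction α using Ordinal.limitRecOn with
  | zero => intro h; rw [nonpos_iff_eq_zero.1 h]
  | add_one α ih =>
    intro h
    rcases h.lt_or_eq with h | h
    · rw [iter_succ, ih (Order.lt_add_one_iff.1 h), hγ]
    · rw [h]
  | limit α hα ih =>
    intro h
    apply le_antisymm _ (iter_mono hd x h)
    rw [iter_limit d x α hα]
    refine iSup_le fun β => ?_
    rcases le_total β.1 γ with hb | hb
    · exact iter_mono hd x hb
    · exact (ih β.1 β.2 hb).le

end Iteration

variable {A : Type u} [CompleteLattice A]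

/-- `Boy^∞(j)`, the stationary value of the chain
`j ≤ Boy(j) ≤ Boy²(j) ≤ ⋯` in the complete lattice of nuclei. -/
noncomputable def BoyInf (j : Nucleus A) : Nucleus A := iterInf Boy j

/-- The minimum defining `BoyInf j` is taken over a nonempty set. -/
theorem stableOrdinals_Boy_nonempty (j : Nucleus A) : (stableOrdinals Boy j).Nonempty :=
  stableOrdinals_nonempty le_Boy j

/-- `A_j`, the set of elements fixed by `j`. -/
def fixedSet (j : Nucleus A) : Set A := {a | j a = a}

/-- `b` is essentially above `a`. -/
def EssAbove (a b : A) : Prop := a ≤ b ∧ ∀ y, b ⊓ y ≤ a → y ≤ a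

/-- Cohesive subsets. -/
def IsCohesive (K : Set A) : Prop :=
  K.Nonempty ∧ ∀ a ∈ K, ∃ X ⊆ K, a = sInf X ∧ ∀ x ∈ X, EssAbove a x

end Idiom

namespace Idiom

section Cohesive

variable {A : Type u} [CompleteLattice A]

/-! A cohesive `K ⊆ fixedSet j` survives every Boyle step. Let `a ∈ K`, let `[a, x]` be `j`-full,
and let `y ∈ K` be essentially above `a`. The partial complement `z` of `y ⊓ x` has `y ⊓ z ≤ a`,
hence `z ≤ a`, and so `x ≤ j (y ⊓ x ⊔ z) ≤ j y = y`. Taking the meet over such `y` gives `x ≤ a`: no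
nontrivial full interval starts at `a`. Generating a division set creates none either
(`IsBasic.assoc_Dvs_eq`), which handles successor steps and, through `fixedSet_iSup`, limits.

Conversely, let `Boy k = k`, let `a` be fixed by `k`, and let `b` be the meet of the `k`-fixed
elements essentially above `a`. Pseudocomplements show that `[a, b]` is `k`-full, so `b ≤ Boy k a =
a` and `fixedSet k` is cohesive. Hence `fixedSet (BoyInf j)` is the greatest cohesive subset; the
other two claims follow because a nucleus is determined by its fixed set. -/

/-- Relative pseudocomplements below `b`, from upper continuity. -/
theorem exists_maximal_inf_le [IsIdiom A] {p z a b : A} (hpb : p ≤ b) (hp : z ⊓ p ≤ a) :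
    ∃ y, p ≤ y ∧ y ≤ b ∧ z ⊓ y ≤ a ∧ ∀ w, y ≤ w → w ≤ b → z ⊓ w ≤ a → w = y := by
  obtain ⟨y, hpy, hy⟩ := zorn_le_nonempty₀ {y : A | y ≤ b ∧ z ⊓ y ≤ a} (by
    intro c hc hchain y hy
    refine ⟨sSup c, ⟨sSup_le fun x hx => (hc hx).1, ?_⟩, fun x hx => le_sSup hx⟩
    rw [IsIdiom.inf_sSup_directed z c ⟨y, hy⟩ hchain.directedOn]
    exact iSup₂_le fun x hx => (hc hx).2) p ⟨hpb, hp⟩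
  exact ⟨y, hpy, hy.prop.1, hy.prop.2, fun w hyw hwb hw =>
    (hy.eq_of_le ⟨hwb, hw⟩ hyw).symm⟩

theorem isBasic_divOf (j : Nucleus A) : IsBasic (divOf j) where
  nonempty := ⟨ivl ⊥ ⊥ le_rfl, rfl⟩
  similar := by
    rintro J I ⟨l, r, ⟨rfl, rfl⟩ | ⟨rfl, rfl⟩⟩ h
    · change j (l ⊓ r) = j r at h
      change j l = j (l ⊔ r)
      rw [map_inf, inf_eq_right] at h
      refine le_antisymm (j.monotone le_sup_left) ?_
      calc j (l ⊔ r) ≤ j (j l) := j.monotone (sup_le j.le_apply (j.le_apply.trans h))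
        _ = j l := j.idempotent l
    · change j l = j (l ⊔ r) at h
      change j (l ⊓ r) = j r
      rw [map_inf, inf_eq_right, h]
      exact j.monotone le_sup_right
  subinterval J I hJ hI := by
    have hI' : j I.fst = j I.snd := hI
    refine le_antisymm (j.monotone J.fst_le_snd) ?_
    exact (j.monotone hJ.2).trans (hI'.ge.trans (j.monotone hJ.1))

/-- Modularity transports a partial complement across similar intervals by joining with `l` or
meeting with `r`; for a subinterval it is cut down to `a' ⊔ y ⊓ b'`. -/
theorem IsBasic.fll [IsModularLattice A] {B : Set (NonemptyInterval A)} (hB : IsBasic B) :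
    IsBasic (Fll B) where
  nonempty := by
    refine ⟨ivl ⊥ ⊥ le_rfl, fun x _ hx => ⟨⊥, le_rfl, le_rfl, (inf_bot_eq x).symm, ?_⟩⟩
    obtain rfl : x = ⊥ := le_bot_iff.1 hx
    exact ⟨(sup_idem (⊥ : A)).le, hB.subinterval _ (ivl ⊥ ⊥ le_rfl) ⟨bot_le, le_rfl⟩ (hB.refl_mem ⊥)⟩
  similar := by
    rintro J I ⟨l, r, ⟨rfl, rfl⟩ | ⟨rfl, rfl⟩⟩ h x hlx hxr
    · change l ≤ x at hlx
      change x ≤ l ⊔ r at hxr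
      obtain ⟨y, hy1, hy2, hy3, hy4, hy5⟩ := h (x ⊓ r) (inf_le_inf_right r hlx) inf_le_right
      change l ⊓ r ≤ y at hy1
      change y ≤ r at hy2
      change l ⊓ r = x ⊓ r ⊓ y at hy3
      refine ⟨l ⊔ y, le_sup_left, sup_le_sup_left hy2 l, ?_, ?_⟩
      · change l = x ⊓ (l ⊔ y)
        rw [inf_comm, sup_inf_assoc_of_le y hlx, inf_comm y x]
        rw [inf_assoc, inf_eq_right.2 hy2] at hy3
        rw [← hy3, sup_inf_self]
      · refine ⟨sup_le hxr (sup_le_sup_left hy2 l), ?_⟩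
        have h1 := hB.sup_mem (l := x ⊔ y) hy4 hy5 (sup_le_sup_right inf_le_left y)
        convert h1 using 2
        · rw [← sup_assoc, sup_eq_left.2 hlx]
        · change l ⊔ r = x ⊔ y ⊔ r
          apply le_antisymm
          · exact sup_le_sup_right (hlx.trans le_sup_left) r
          · exact sup_le (sup_le hxr (hy2.trans le_sup_right)) le_sup_right
    · change l ⊓ r ≤ x at hlx
      change x ≤ r at hxr
      obtain ⟨y, hy1, hy2, hy3, hy4, hy5⟩ := h (l ⊔ x) le_sup_left (sup_le_sup_left hxr l)
      change l ≤ y at hy1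
      change y ≤ l ⊔ r at hy2
      change l = (l ⊔ x) ⊓ y at hy3
      have e : x ⊔ y ⊓ r = (l ⊔ x ⊔ y) ⊓ r := by
        rw [← sup_inf_assoc_of_le y hxr, sup_comm l x, sup_assoc, sup_eq_right.2 hy1]
      refine ⟨y ⊓ r, inf_le_inf_right r hy1, inf_le_right, ?_, ?_⟩
      · change l ⊓ r = x ⊓ (y ⊓ r)
        apply le_antisymm
        · exact le_inf hlx (inf_le_inf_right r hy1)
        · rw [← inf_assoc]
          exact inf_le_inf_right r ((inf_le_inf_right y le_sup_right).trans hy3.ge)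
      · exact ⟨sup_le hxr inf_le_right, hB.inf_mem hy4 hy5 le_sup_right e _⟩
  subinterval := by
    rintro ⟨⟨a', b'⟩, hab'⟩ ⟨⟨a, b⟩, hab⟩ ⟨ha, hb⟩ h x hax hxb
    change a ≤ a' at ha
    change b' ≤ b at hb
    change a' ≤ b' at hab'
    change a' ≤ x at hax
    change x ≤ b' at hxb
    obtain ⟨y, hy1, hy2, hy3, hy4, hy5⟩ := h x (ha.trans hax) (hxb.trans hb)
    change a = x ⊓ y at hy3
    have e : x ⊔ (a' ⊔ y ⊓ b') = (x ⊔ y) ⊓ b' := by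
      rw [← sup_assoc, sup_eq_left.2 hax, sup_inf_assoc_of_le y hxb]
    refine ⟨a' ⊔ y ⊓ b', le_sup_left, sup_le hab' inf_le_right, ?_, ?_⟩
    · change a' = x ⊓ (a' ⊔ y ⊓ b')
      rw [inf_comm, sup_inf_assoc_of_le _ hax, inf_comm (y ⊓ b') x, eq_comm, sup_eq_left]
      exact (inf_le_inf_left x inf_le_left).trans (hy3.ge.trans ha)
    · exact ⟨sup_le hxb (sup_le hab' inf_le_right), hB.inf_mem hy4 hy5 hb e _⟩

/-! ### Controlling the generated division set -/

/-- The intervals all of whose proper end segments begin with a nontrivial member of `B`. -/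
def locally (B : Set (NonemptyInterval A)) : Set (NonemptyInterval A) :=
  {I | ∀ x, I.fst ≤ x → x < I.snd → ∃ y, ∃ h : x < y, y ≤ I.snd ∧ ivl x y h.le ∈ B}

theorem IsBasic.subset_locally {B : Set (NonemptyInterval A)} (hB : IsBasic B) :
    B ⊆ locally B :=
  fun I hI _ hx hxI => ⟨I.snd, hxI, le_rfl, hB.subinterval _ I ⟨hx, le_rfl⟩ hI⟩

/-- If `[a, b]` is locally in `B`, `a ≤ x` and `b ≰ x`, then `B` has a nontrivial
interval `[x, y]` with `y ≤ x ∨ b`. -/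
theorem IsBasic.exists_lt_of_locally {B : Set (NonemptyInterval A)} (hB : IsBasic B)
    {a b x : A} (hab : a ≤ b) (h : ivl a b hab ∈ locally B) (hax : a ≤ x) (hbx : ¬ b ≤ x) :
    ∃ y, ∃ h : x < y, y ≤ x ⊔ b ∧ ivl x y h.le ∈ B := by
  obtain ⟨y, hy1, hy2, hy3⟩ := h (x ⊓ b) (le_inf hax hab) (inf_lt_right.2 hbx)
  change y ≤ b at hy2
  have hyx : ¬ y ≤ x := fun h' => hy1.not_ge (le_inf h' hy2)
  exact ⟨x ⊔ y, left_lt_sup.2 hyx, sup_le_sup_left hy2 x, hB.sup_mem hy1.le hy3 inf_le_left⟩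

/-- Upper continuity enters only in `subinterval`, where a smaller right end point calls for a
pseudocomplement. -/
theorem IsBasic.isDivision_locally [IsIdiom A] {B : Set (NonemptyInterval A)} (hB : IsBasic B) :
    IsDivision (locally B) where
  nonempty := hB.nonempty.mono hB.subset_locally
  similar := by
    rintro J I ⟨l, r, ⟨rfl, rfl⟩ | ⟨rfl, rfl⟩⟩ h x hlx hxr
    · change l ≤ x at hlx
      change x < l ⊔ r at hxr
      obtain ⟨y, hy, hy2, hy3⟩ := hB.exists_lt_of_locally inf_le_right h (inf_le_left.trans hlx)
        (fun h' => hxr.not_ge (sup_le hlx h'))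
      exact ⟨y, hy, hy2.trans (sup_le hxr.le le_sup_right), hy3⟩
    · change l ⊓ r ≤ x at hlx
      change x < r at hxr
      -- By modularity, meeting with `r` undoes joining with `l`, so strict inequalities are
      -- preserved.
      have e : (l ⊔ x) ⊓ r = x := by
        rw [sup_comm, sup_inf_assoc_of_le l hxr.le, sup_eq_left]
        exact hlx
      obtain ⟨y, hy, hy2, hy3⟩ := h (l ⊔ x) le_sup_left (by
        refine lt_of_le_of_ne (sup_le_sup_left hxr.le l) fun h' => hxr.ne ?_
        change l ⊔ x = l ⊔ r at h'
        rw [← e, h', inf_eq_right]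
        exact le_sup_right)
      change y ≤ l ⊔ r at hy2
      have hx : x ≤ y ⊓ r := le_inf (le_sup_right.trans hy.le) hxr.le
      refine ⟨y ⊓ r, lt_of_le_of_ne hx fun h' => hy.ne ?_, inf_le_right,
        hB.inf_mem hy.le hy3 inf_le_left ?_ _⟩
      · have hly : l ≤ y := le_sup_left.trans hy.le
        rw [h', inf_comm y r, ← sup_inf_assoc_of_le r hly, inf_eq_right.2 hy2]
      · rw [inf_comm y r, ← inf_assoc, e]
        exact (inf_eq_left.2 (le_sup_right.trans hy.le)).symm
  subinterval := by
    rintro ⟨⟨a', b'⟩, hab'⟩ ⟨⟨a, b⟩, hab⟩ ⟨ha, hb⟩ h x hax hxb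
    change a ≤ a' at ha
    change b' ≤ b at hb
    change a' ≤ x at hax
    change x < b' at hxb
    -- Push `x` up to a maximal `y` with `b' ⊓ y ≤ x`. Any step from `y` to a larger `z ≤ b` then
    -- remains strict after meeting with `b'`.
    obtain ⟨y, hy1, hy2, hy3, hy4⟩ := exists_maximal_inf_le (hxb.le.trans hb)
      (inf_le_right : b' ⊓ x ≤ x)
    have hyb : y < b := by
      refine lt_of_le_of_ne hy2 fun h' => ?_
      rw [h', inf_eq_left.2 hb] at hy3
      exact hxb.not_ge hy3
    obtain ⟨z, hz1, hz2, hz3⟩ := h y ((ha.trans hax).trans hy1) hyb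
    have hx : x ≤ b' ⊓ z := le_inf hxb.le (hy1.trans hz1.le)
    refine ⟨b' ⊓ z, lt_of_le_of_ne hx fun h' => ?_, inf_le_left,
      hB.inf_mem hz1.le hz3 inf_le_right ?_ _⟩
    · exact hz1.ne (hy4 z hz1.le hz2 h'.ge).symm
    · apply le_antisymm (le_inf hy1 hx)
      exact (le_inf (inf_le_right.trans inf_le_left) inf_le_left).trans hy3
  abut a b c hab hbc h1 h2 x hax hxc := by
    by_cases hbx : b ≤ x
    · exact h2 x hbx hxc
    · obtain ⟨y, hy, hy2, hy3⟩ := hB.exists_lt_of_locally hab h1 hax hbx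
      exact ⟨y, hy, hy2.trans (sup_le hxc.le hbc), hy3⟩
  sup a X _ hX _ hD x hax hxs := by
    obtain ⟨b, hb, hbx⟩ : ∃ b ∈ X, ¬ b ≤ x := by
      by_contra! h'
      exact hxs.not_ge (sSup_le h')
    obtain ⟨y, hy, hy2, hy3⟩ := hB.exists_lt_of_locally (hX b hb) (hD b hb) hax hbx
    exact ⟨y, hy, hy2.trans (sup_le hxs.le (le_sSup hb)), hy3⟩

/-- `Dvs B` lies inside the division set `locally B`, whose nontrivial intervals from `a` begin with
a nontrivial member of `B` from `a`. -/
theorem IsBasic.assoc_Dvs_eq [IsIdiom A] {B : Set (NonemptyInterval A)} (hB : IsBasic B) {a : A}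
    (ha : ∀ x, ∀ h : a ≤ x, ivl a x h ∈ B → x ≤ a) : assoc (Dvs B) a = a := by
  refine le_antisymm (sSup_le ?_) ((isDivision_Dvs B).le_assoc a)
  rintro x ⟨hax, hx⟩
  have hloc : ivl a x hax ∈ locally B := hx _ ⟨hB.isDivision_locally, hB.subset_locally⟩
  by_contra hxa
  obtain ⟨y, hy, _, hyB⟩ := hloc a le_rfl (lt_of_le_not_ge hax hxa)
  exact hy.not_ge (ha y hy.le hyB)

/-! ### Cohesive sets along the Boyle chain -/

theorem IsCohesive.subset_fixedSet_Boy [IsIdiom A] {K : Set A} (hK : IsCohesive K)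
    {j : Nucleus A} (hKj : K ⊆ fixedSet j) : K ⊆ fixedSet (Boy j) := by
  intro a ha
  refine (isBasic_divOf j).fll.assoc_Dvs_eq fun x hax hx => ?_
  obtain ⟨X, hXK, haX, hX⟩ := hK.2 a ha
  rw [haX]
  refine le_sInf fun y hy => ?_
  obtain ⟨hay, hess⟩ := hX y hy
  obtain ⟨z, hz1, hz2, hz3, hz4, hz5⟩ := hx (y ⊓ x) (le_inf hay hax) inf_le_right
  change a = y ⊓ x ⊓ z at hz3
  change z ≤ x at hz2
  rw [inf_assoc, inf_eq_right.2 hz2] at hz3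
  have hza : z ≤ a := hess z hz3.ge
  change j (y ⊓ x ⊔ z) = j x at hz5
  calc x ≤ j x := j.le_apply
    _ = j (y ⊓ x ⊔ z) := hz5.symm
    _ ≤ j y := j.monotone (sup_le inf_le_left (hza.trans hay))
    _ = y := hKj (hXK hy)

/-- The supremum of nuclei is not pointwise, but it lies below the nucleus of the division set
generated by all the `divOf (j i)`, whose union is basic. -/
theorem fixedSet_iSup [IsIdiom A] {ι : Sort*} [Nonempty ι] (j : ι → Nucleus A) {a : A}
    (ha : ∀ i, a ∈ fixedSet (j i)) : a ∈ fixedSet (⨆ i, j i) := by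
  have hB : IsBasic (⋃ i, divOf (j i)) :=
    { nonempty := ⟨ivl ⊥ ⊥ le_rfl, Set.mem_iUnion.2 ⟨Classical.arbitrary ι, rfl⟩⟩
      similar := fun J I h hI => by
        obtain ⟨i, hi⟩ := Set.mem_iUnion.1 hI
        exact Set.mem_iUnion.2 ⟨i, (isBasic_divOf (j i)).similar J I h hi⟩
      subinterval := fun J I h hI => by
        obtain ⟨i, hi⟩ := Set.mem_iUnion.1 hI
        exact Set.mem_iUnion.2 ⟨i, (isBasic_divOf (j i)).subinterval J I h hi⟩ }
  have hle : ⨆ i, j i ≤ nucleusOf _ (isDivision_Dvs (⋃ i, divOf (j i))) := by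
    refine iSup_le fun i x => le_sSup ⟨(j i).le_apply, fun D hD => hD.2 ?_⟩
    exact Set.mem_iUnion.2 ⟨i, ((j i).idempotent x).symm⟩
  refine le_antisymm ((hle a).trans ?_) (⨆ i, j i).le_apply
  refine (hB.assoc_Dvs_eq fun x hax hx => ?_).le
  obtain ⟨i, hi⟩ := Set.mem_iUnion.1 hx
  change j i a = j i x at hi
  exact (j i).le_apply.trans (hi.ge.trans (ha i).le)

theorem IsCohesive.subset_fixedSet_iter [IsIdiom A] {K : Set A} (hK : IsCohesive K)
    {j : Nucleus A} (hKj : K ⊆ fixedSet j) (α : Ordinal.{u}) :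
    K ⊆ fixedSet (iter Boy j α) := by
  induction α using Ordinal.limitRecOn with
  | zero => rwa [iter_zero]
  | add_one α ih => rw [iter_succ]; exact hK.subset_fixedSet_Boy ih
  | limit α hα ih =>
    rw [iter_limit _ _ _ hα]
    have : Nonempty (Set.Iio α) := ⟨⟨0, hα.bot_lt⟩⟩
    exact fun a ha => fixedSet_iSup _ fun β => ih β.1 β.2 ha

theorem Boy_BoyInf (j : Nucleus A) : Boy (BoyInf j) = BoyInf j := by
  unfold BoyInf iterInf
  rw [← iter_succ Boy]
  exact csInf_mem (stableOrdinals_Boy_nonempty j) _ (Order.le_succ _)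

theorem le_BoyInf (j : Nucleus A) : j ≤ BoyInf j := by
  conv_lhs => rw [← iter_zero Boy j]
  exact iter_mono le_Boy j zero_le

theorem fixedSet_anti {j k : Nucleus A} (h : j ≤ k) : fixedSet k ⊆ fixedSet j :=
  fun a ha => le_antisymm ((h a).trans (le_of_eq ha)) j.le_apply

theorem le_of_fixedSet_subset {j k : Nucleus A} (h : fixedSet k ⊆ fixedSet j) : j ≤ k := by
  intro x
  have hx : j (k x) = k x := h (k.idempotent x)
  exact (j.monotone k.le_apply).trans hx.le

theorem fixedSet_injective : Function.Injective (fixedSet : Nucleus A → Set A) :=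
  fun _ _ h => le_antisymm (le_of_fixedSet_subset h.ge) (le_of_fixedSet_subset h.le)

/-! ### Cohesion at a fixed point of `Boy` -/

theorem EssAbove.mono {a b c : A} (h : EssAbove a b) (hbc : b ≤ c) : EssAbove a c :=
  ⟨h.1.trans hbc, fun y hy => h.2 y ((inf_le_inf_right y hbc).trans hy)⟩

/-- The join of `z` with a pseudocomplement over `a` is essentially above `a`. -/
theorem essAbove_sup_of_maximal [IsModularLattice A] {a z y : A} (hay : a ≤ y)
    (hzy : z ⊓ y ≤ a) (hmax : ∀ w, y ≤ w → z ⊓ w ≤ a → w = y) : EssAbove a (z ⊔ y) := by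
  refine ⟨hay.trans le_sup_right, fun w hw => ?_⟩
  -- Modularity keeps `z ⊓ (y ⊔ w)` below `y`, so maximality of `y` absorbs `w`.
  have h1 : z ⊓ (y ⊔ w) ≤ y := by
    calc z ⊓ (y ⊔ w) ≤ (y ⊔ w) ⊓ (z ⊔ y) :=
          le_inf inf_le_right (inf_le_left.trans le_sup_left)
      _ = y ⊔ w ⊓ (z ⊔ y) := sup_inf_assoc_of_le w le_sup_right
      _ ≤ y := sup_le le_rfl (by rw [inf_comm]; exact hw.trans hay)
  have h2 : y ⊔ w = y := hmax _ le_sup_left ((le_inf inf_le_left h1).trans hzy)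
  have h3 : w ≤ y := sup_eq_left.1 h2
  exact (le_inf (h3.trans le_sup_right) le_rfl).trans hw

theorem isCohesive_fixedSet_of_Boy_eq [IsIdiom A] {k : Nucleus A} (hk : Boy k = k) :
    IsCohesive (fixedSet k) := by
  refine ⟨⟨k ⊥, k.idempotent ⊥⟩, fun a ha => ?_⟩
  refine ⟨{x | k x = x ∧ EssAbove a x}, fun x hx => hx.1, ?_, fun x hx => hx.2⟩
  set b := sInf {x | k x = x ∧ EssAbove a x} with hb
  have hab : a ≤ b := le_sInf fun x hx => hx.2.1
  refine le_antisymm hab ?_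
  have hfull : ivl a b hab ∈ Fll (divOf k) := by
    intro z haz hzb
    change a ≤ z at haz
    change z ≤ b at hzb
    -- The pseudocomplement is taken in all of `A`, so that `k (z ⊔ y)` is one of the elements whose
    -- meet is `b`; only afterwards is `y` cut down to `y ⊓ b`.
    obtain ⟨y, hy1, _, hy3, hy4⟩ := exists_maximal_inf_le (z := z) (le_top : a ≤ ⊤)
      (inf_le_right : z ⊓ a ≤ a)
    have hess := essAbove_sup_of_maximal hy1 hy3 fun w hw => hy4 w hw le_top
    have hbk : b ≤ k (z ⊔ y) := sInf_le ⟨k.idempotent _, hess.mono k.le_apply⟩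
    refine ⟨y ⊓ b, le_inf hy1 hab, inf_le_right, ?_, sup_le hzb inf_le_right, ?_⟩
    · change a = z ⊓ (y ⊓ b)
      exact le_antisymm (le_inf haz (le_inf hy1 hab))
        ((inf_le_inf_left z inf_le_left).trans hy3)
    · change k (z ⊔ y ⊓ b) = k b
      rw [← sup_inf_assoc_of_le y hzb, map_inf, inf_eq_right]
      exact (k.monotone hbk).trans (k.idempotent _).le
  calc b ≤ Boy k a := le_sSup ⟨hab, fun D hD => hD.2 hfull⟩
    _ = k a := by rw [hk]
    _ = a := ha

theorem isGreatest_fixedSet_BoyInf [IsIdiom A] (j : Nucleus A) :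
    IsGreatest {K : Set A | K ⊆ fixedSet j ∧ IsCohesive K} (fixedSet (BoyInf j)) :=
  ⟨⟨fixedSet_anti (le_BoyInf j), isCohesive_fixedSet_of_Boy_eq (Boy_BoyInf j)⟩,
    fun _ hK => hK.2.subset_fixedSet_iter hK.1 _⟩

theorem fixedSet_top : fixedSet (⊤ : Nucleus A) = {⊤} := by
  ext a
  exact eq_comm

theorem isCohesive_singleton_top : IsCohesive ({⊤} : Set A) := by
  refine ⟨Set.singleton_nonempty _, fun a ha => ⟨∅, Set.empty_subset _, ?_, fun x hx => hx.elim⟩⟩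
  rw [sInf_empty]
  exact ha

end Cohesive

end Idiom

theorem mainTheorem4 (A : Type u) [CompleteLattice A] [IsIdiom A] (j : Nucleus A) :
    (Idiom.BoyInf j = ⊤ ↔
      ∀ K : Set A, (K ⊆ Idiom.fixedSet j ∧ Idiom.IsCohesive K) ↔ K = {⊤}) ∧
    IsGreatest {K : Set A | K ⊆ Idiom.fixedSet j ∧ Idiom.IsCohesive K}
      (Idiom.fixedSet (Idiom.BoyInf j)) ∧
    (Idiom.BoyInf j = j ↔ Idiom.IsCohesive (Idiom.fixedSet j)) := by
  have hg := Idiom.isGreatest_fixedSet_BoyInf j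
  refine ⟨⟨fun h K => ⟨fun hK => ?_, ?_⟩, fun h => ?_⟩, hg, ⟨fun h => ?_, fun h => ?_⟩⟩
  · have hsub := hg.2 hK
    rw [h, Idiom.fixedSet_top] at hsub
    -- Nonemptiness of cohesive sets excludes `∅`.
    exact (Set.subset_singleton_iff_eq.1 hsub).resolve_left hK.2.1.ne_empty
  · rintro rfl
    exact ⟨Set.singleton_subset_iff.2 (top_le_iff.1 j.le_apply), Idiom.isCohesive_singleton_top⟩
  · apply Idiom.fixedSet_injective
    rw [Idiom.fixedSet_top]
    exact (h _).1 hg.1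
  · have := hg.1.2
    rwa [h] at this
  · exact le_antisymm (Idiom.le_of_fixedSet_subset (hg.2 ⟨subset_rfl, h⟩)) (Idiom.le_BoyInf j)
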